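/- **Setting.** Let $(\Omega,\mathcal F,\mathbb P)$ be a probability space and let $(\tau_x)_{x\in\mathbb R}$ be a one-parameter group ($\tau_0=\mathrm{id}$, $\tau_{x+y}=\tau_x\circ\tau_y$) of measurable, $\mathbb P$-preserving maps $\tau_x:\Omega\to\Omega$ which is ergodic: every measurable $\varphi:\Omega\to\mathbb R$ such that, for each fixed $x\in\mathbb R$, $\varphi\circ\tau_x=\varphi$ almost surely, is almost surely constant. A jointly measurable $f:\mathbb R\times\Omega\to\mathbb R$ is called *stationary* if $f(x+y,\omega)=f(x,\tau_y\omega)$ for all $x,y\in\mathbb R$, $\omega\in\Omega$. Let $\kappa>0$ and let $a:\mathbb R\times\Omega\to[0,1]$ be stationary, with $a(\cdot,\omega)>0$ on $\mathbb R$ for almost every $\omega$, and $\sqrt{a(\cdot,\omega)}$ $\kappa$-Lipschitz for every $\omega$. Let $\alpha_0,\alpha_1>0$, $\gamma>2$, and let $H:\mathbb R\times\mathbb R\times\Omega\to\mathbb R$ be jointly measurable, with $H(x+y,p,\omega)=H(x,p,\tau_y\omega)$, and such that, for all $x,y,p,q\in\mathbb R$ and $\omega\in\Omega$, * $\alpha_0|p|^\gamma-1/\alpha_0\le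 H(x,p,\omega)\le\alpha_1(|p|^\gamma+1)$, * $|H(x,p,\omega)-H(x,q,\omega)|\le\alpha_1(|p|+|q|+1)^{\gamma-1}|p-q|$, * $|H(x,p,\omega)-H(y,p,\omega)|\le\alpha_1(|p|^\gamma+1)|x-y|$. For $\omega\in\Omega$ let $\lambda_0(\omega)$ be the infimum of the $\lambda\in\mathbb R$ for which $a(x,\omega)u''+H(x,u',\omega)=\lambda$ in $\mathbb R$ admits a continuous viscosity supersolution, i.e. a continuous $u$ such that $a(x_0,\omega)\varphi''(x_0)+H(x_0,\varphi'(x_0),\omega)\le\lambda$ whenever $\varphi\in C^2(\mathbb R)$ and $u-\varphi$ has a local minimum at $x_0$. The function $\lambda_0(\cdot)$ is almost surely equal to a constant; denote by $\lambda_0$ this constant (the essential supremum of $\lambda_0(\cdot)$). For $\lambda\in\mathbb R$ let $\mathcal S_\lambda$ be the set of essentially bounded stationary functions $f:\mathbb R\times\Omega\to\mathbb R$ such that, for almost every $\omega$, $f(\cdot,\omega)$ is a bounded $C^1$ solution of $a(x,\omega)f'+H(x,f,\omega)=\lambda$ in $\mathbb R$. For $\lambda\ge\lambda_0$ set $\Theta(\lambda):=\{\mathbb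 E[f(0,\cdot)] : f\in\mathcal S_\lambda\}$. **Proposition.** The set $\operatorname{Im}(\Theta):=\bigcup_{\lambda\ge\lambda_0}\Theta(\lambda)$ is a closed and unbounded subset of $\mathbb R$. -/

import Mathlib

open MeasureTheory

noncomputable section

namespace ViscousHJ

/-- A one-parameter group `(τ_x)_{x ∈ ℝ}` of measure-preserving transformations of the probability
space `(Ω, P)` whose action is ergodic: a measurable function which, for every fixed `x`, is almost
surely invariant under `τ_x` is almost surely constant. -/
structure IsErgodicFlow {Ω : Type*} [MeasurableSpace Ω] (P : Measure Ω) (τ : ℝ → Ω → Ω) :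
    Prop where
  zero : ∀ ω, τ 0 ω = ω
  add : ∀ x y ω, τ (x + y) ω = τ x (τ y ω)
  measurePreserving : ∀ x, MeasurePreserving (τ x) P P
  ergodic : ∀ φ : Ω → ℝ, Measurable φ → (∀ x, ∀ᵐ ω ∂P, φ (τ x ω) = φ ω) →
    ∃ c : ℝ, ∀ᵐ ω ∂P, φ ω = c

/-- Stationary random functions `f : ℝ × Ω → ℝ` (joint measurability is part of the notion). -/
structure IsStationary {Ω : Type*} [MeasurableSpace Ω] (τ : ℝ → Ω → Ω) (f : ℝ → Ω → ℝ) :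
    Prop where
  measurable : Measurable (fun z : ℝ × Ω => f z.1 z.2)
  shift : ∀ x y ω, f (x + y) ω = f x (τ y ω)

/-- The standing assumptions on the diffusion coefficient `a : ℝ × Ω → [0,1]`: it is stationary,
almost surely positive on `ℝ`, and `√a(·,ω)` is `κ`-Lipschitz for every `ω`. -/
structure IsDiffusion {Ω : Type*} [MeasurableSpace Ω] (P : Measure Ω) (τ : ℝ → Ω → Ω) (κ : ℝ)
    (a : ℝ → Ω → ℝ) : Prop where
  stationary : IsStationary τ a
  mem_Icc : ∀ x ω, a x ω ∈ Set.Icc (0 : ℝ) 1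
  pos : ∀ᵐ ω ∂P, ∀ x, 0 < a x ω
  sqrt_lipschitz : ∀ x y ω, |√(a x ω) - √(a y ω)| ≤ κ * |x - y|

/-- Hamiltonians `H(x,p,ω)`, jointly measurable and stationary with respect to shifts in `x`. -/
structure IsStationaryHamiltonian {Ω : Type*} [MeasurableSpace Ω] (τ : ℝ → Ω → Ω)
    (H : ℝ → ℝ → Ω → ℝ) : Prop where
  measurable : Measurable (fun z : ℝ × ℝ × Ω => H z.1 z.2.1 z.2.2)
  shift : ∀ x y p ω, H (x + y) p ω = H x p (τ y ω)

/-- The class `ℋ(α₀, α₁, γ)` of Hamiltonians `H(x,p,ω)`. -/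
structure HamiltonianClass {Ω : Type*} (α₀ α₁ γ : ℝ) (H : ℝ → ℝ → Ω → ℝ) : Prop where
  growth_lower : ∀ x p ω, α₀ * |p| ^ γ - 1 / α₀ ≤ H x p ω
  growth_upper : ∀ x p ω, H x p ω ≤ α₁ * (|p| ^ γ + 1)
  lipschitz_p : ∀ x p q ω, |H x p ω - H x q ω| ≤ α₁ * (|p| + |q| + 1) ^ (γ - 1) * |p - q|
  lipschitz_x : ∀ x y p ω, |H x p ω - H y p ω| ≤ α₁ * (|p| ^ γ + 1) * |x - y|

/-- `u` is a continuous viscosity supersolution of `a(x) u'' + H(x,u') = l` in `ℝ`: the inequality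
`a(x₀) φ''(x₀) + H(x₀, φ'(x₀)) ≤ l` holds for every `C²` function `φ` touching `u` from below
at `x₀`. -/
def IsViscositySupersolution (a : ℝ → ℝ) (H : ℝ → ℝ → ℝ) (l : ℝ) (u : ℝ → ℝ) : Prop :=
  Continuous u ∧ ∀ (φ : ℝ → ℝ) (x₀ : ℝ), ContDiff ℝ 2 φ → IsLocalMin (fun x => u x - φ x) x₀ →
    a x₀ * deriv (deriv φ) x₀ + H x₀ (deriv φ x₀) ≤ l

/-- The critical value `λ₀(ω)`: the infimum (in the extended reals) of the levels `l ∈ ℝ` at which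
`a(x,ω) u'' + H(x,u',ω) = l` admits a continuous viscosity supersolution. -/
def criticalValue {Ω : Type*} (a : ℝ → Ω → ℝ) (H : ℝ → ℝ → Ω → ℝ) (ω : Ω) : EReal :=
  sInf {e : EReal | ∃ l : ℝ, e = (l : EReal) ∧
    ∃ u : ℝ → ℝ, IsViscositySupersolution (fun x => a x ω) (fun x p => H x p ω) l u}

/-- The constant `λ₀` to which the random variable `λ₀(·)` is almost surely equal, obtained as its
essential supremum. -/
def lambdaZero {Ω : Type*} [MeasurableSpace Ω] (P : Measure Ω) (a : ℝ → Ω → ℝ)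
    (H : ℝ → ℝ → Ω → ℝ) : EReal :=
  essSup (criticalValue a H) P

/-- `f` is a `C¹` solution of the ODE `a(x) f' + H(x,f) = l` in `ℝ`. -/
def IsC1Solution (a : ℝ → ℝ) (H : ℝ → ℝ → ℝ) (l : ℝ) (f : ℝ → ℝ) : Prop :=
  ContDiff ℝ 1 f ∧ ∀ x, a x * deriv f x + H x (f x) = l

/-- The family `𝒮_l` of essentially bounded, jointly measurable, stationary functions
`f : ℝ × Ω → ℝ` such that `f(·,ω)` is almost surely a (bounded) `C¹` solution of
`a(x,ω) f' + H(x,f,ω) = l`. As `f(·,ω)` is almost surely continuous, essential boundedness on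
`ℝ × Ω` means that almost surely `|f(x,ω)| ≤ C` for all `x`, with `C` deterministic. -/
structure IsStationarySolution {Ω : Type*} [MeasurableSpace Ω] (P : Measure Ω) (τ : ℝ → Ω → Ω)
    (a : ℝ → Ω → ℝ) (H : ℝ → ℝ → Ω → ℝ) (l : ℝ) (f : ℝ → Ω → ℝ) : Prop where
  stationary : IsStationary τ f
  bounded : ∃ C : ℝ, ∀ᵐ ω ∂P, ∀ x, |f x ω| ≤ C
  solution : ∀ᵐ ω ∂P, IsC1Solution (fun x => a x ω) (fun x p => H x p ω) l (fun x => f x ω)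

/-- `Θ(l) = { 𝔼[f(0,·)] : f ∈ 𝒮_l }`. -/
def Theta {Ω : Type*} [MeasurableSpace Ω] (P : Measure Ω) (τ : ℝ → Ω → Ω)
    (a : ℝ → Ω → ℝ) (H : ℝ → ℝ → Ω → ℝ) (l : ℝ) : Set ℝ :=
  {θ | ∃ f : ℝ → Ω → ℝ, IsStationarySolution P τ a H l f ∧ θ = ∫ ω, f 0 ω ∂P}

/-- `Im(Θ)`, the union of the sets `Θ(l)` over all real `l ≥ λ₀`. -/
def imTheta {Ω : Type*} [MeasurableSpace Ω] (P : Measure Ω) (τ : ℝ → Ω → Ω)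
    (a : ℝ → Ω → ℝ) (H : ℝ → ℝ → Ω → ℝ) : Set ℝ :=
  ⋃ (l : ℝ) (_ : lambdaZero P a H ≤ (l : EReal)), Theta P τ a H l

end ViscousHJ

end

/-! Two principles drive the proof. First, suppose a stationary process strictly increases whenever
its value lies in `(α, β)`. Its truncation to `[α, β]` is then nondecreasing in `x`; invariance of
`P` makes each increment vanish almost surely, and ergodicity makes the truncation constant. So the
process stays on one side of the band (`le_or_ge_of_deriv_pos`). Since `a f' = l - H(x, f)`, the
growth bounds on `H` turn this into estimates: the level bounds `|f|`, is at least `-1/α₀`, and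
forces a large mean when it is large.

Second, comparison for the ODE makes the event `g(0) ≤ f(0)` forward invariant when the level of `g`
is at most that of `f`. By ergodicity any two stationary solutions are ordered, even across levels,
and the order is that of their means (`ae_le_of_integral_le`).

Closedness: convergent means have bounded levels and uniformly bounded solutions. Along a
subsequence the levels converge and the means are monotone, hence so are the solutions for almost
every `ω`; their pointwise limit is a stationary solution at the limit level with the limit mean.
The constraint `l ≥ λ₀` is automatic, because a primitive of a solution is a supersolution.

Unboundedness: for any `r ≥ 0`, a suitable level admits the constant `r` as a subsolution and some
constant `M ≥ r` as a supersolution. Monotone iteration of an integral equation, started at `M`,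
gives a stationary solution between them (`exists_isStationarySolution`), whose mean is at least
`r`. -/

namespace ViscousHJ

open Set Filter Topology

/-! ### Deterministic facts about the ODE -/

/-- A function which increases strictly while it takes values in `(α, β)` becomes monotone when it
is truncated to `[α, β]`. -/
theorem monotone_clamp_of_deriv_pos {f : ℝ → ℝ} {α β : ℝ} (hf : Differentiable ℝ f)
    (h : ∀ x, f x ∈ Ioo α β → 0 < deriv f x) : Monotone fun x => max α (min β (f x)) := by
  -- A level strictly inside the band can only be crossed upwards.
  have key : ∀ c ∈ Ioo α β, ∀ x y, x ≤ y → c ≤ f x → c ≤ f y := by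
    intro c hc x y hxy hx
    refine image_le_of_deriv_right_lt_deriv_boundary (f := fun _ => c) (f' := fun _ => 0)
      (a := x) (b := y) (B := f) (B' := deriv f) continuousOn_const
      (fun t _ => hasDerivWithinAt_const _ _ _) hx (fun t => (hf t).hasDerivAt)
      (fun t _ ht => h t (ht ▸ hc)) (right_mem_Icc.2 hxy)
  intro x y hxy
  by_contra! hlt
  obtain ⟨c, hc1, hc2⟩ := exists_between hlt
  have h1 : α < c := (le_max_left _ _).trans_lt hc1
  have h2 : c < β := hc2.trans_le (by
    refine max_le ?_ (min_le_left _ _)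
    by_contra! hβ
    have := hc2
    simp only [lt_max_iff, lt_min_iff] at this
    rcases this with h | h <;> linarith)
  have h3 : c ≤ f x := by
    rcases lt_max_iff.1 hc2 with h | h
    · linarith
    · exact (lt_min_iff.1 h).2.le
  have h4 := key c ⟨h1, h2⟩ x y hxy h3
  have : c ≤ min β (f y) := le_min h2.le h4
  exact absurd (this.trans (le_max_right α _)) (not_le.2 hc1)

theorem IsC1Solution.deriv_eq {a : ℝ → ℝ} {H : ℝ → ℝ → ℝ} {l : ℝ} {f : ℝ → ℝ}
    (hf : IsC1Solution a H l f) (hpos : ∀ x, 0 < a x) (x : ℝ) :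
    deriv f x = (l - H x (f x)) / a x := by
  rw [eq_div_iff (hpos x).ne', ← hf.2 x]; ring

theorem IsC1Solution.hasDerivAt {a : ℝ → ℝ} {H : ℝ → ℝ → ℝ} {l : ℝ} {f : ℝ → ℝ}
    (hf : IsC1Solution a H l f) (hpos : ∀ x, 0 < a x) (x : ℝ) :
    HasDerivAt f ((l - H x (f x)) / a x) x := by
  rw [← hf.deriv_eq hpos]
  exact (hf.1.differentiable one_ne_zero x).hasDerivAt

/-- Forward comparison for ordered levels. -/
theorem IsC1Solution.le_of_le {a : ℝ → ℝ} {H : ℝ → ℝ → ℝ} {l m K : ℝ} {f g : ℝ → ℝ}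
    (ha : Continuous a) (hpos : ∀ x, 0 < a x) (hf : IsC1Solution a H l f)
    (hg : IsC1Solution a H m g) (hml : m ≤ l) (hK : 0 ≤ K)
    (hL : ∀ x, |H x (f x) - H x (g x)| ≤ K * |f x - g x|) {x₀ x : ℝ} (hx : x₀ ≤ x)
    (h0 : g x₀ ≤ f x₀) : g x ≤ f x := by
  obtain ⟨z, -, hz⟩ := isCompact_Icc.exists_isMinOn (nonempty_Icc.2 hx) ha.continuousOn
  set δ := a z
  have hδ : 0 < δ := hpos z
  -- Barrier `e * exp (L * (t - x₀))` for `g - f`: at a contact point the slope of `g - f` is at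
  -- most `K / δ` times its value, and the `+ 1` makes the barrier strictly steeper. The factor `e`
  -- makes the barrier equal `ε` at `x`.
  set L := K / δ + 1
  refine le_of_forall_pos_le_add fun ε hε => ?_
  set e := ε / Real.exp (L * (x - x₀))
  have he : 0 < e := by positivity
  have hBd : ∀ t, HasDerivAt (fun t => e * Real.exp (L * (t - x₀)))
      (e * Real.exp (L * (t - x₀)) * L) t := by
    intro t
    have h1 : HasDerivAt (fun t => L * (t - x₀)) L t := by
      simpa using ((hasDerivAt_id t).sub_const x₀).const_mul L
    simpa only [mul_assoc] using h1.exp.const_mul e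
  have hw : ∀ t, HasDerivAt (fun t => g t - f t)
      ((m - H t (g t)) / a t - (l - H t (f t)) / a t) t :=
    fun t => (hg.hasDerivAt hpos t).sub (hf.hasDerivAt hpos t)
  have := image_le_of_deriv_right_lt_deriv_boundary (f := fun t => g t - f t) (a := x₀) (b := x)
    (fun t _ => (hw t).continuousAt.continuousWithinAt) (fun t _ => (hw t).hasDerivWithinAt)
    (B := fun t => e * Real.exp (L * (t - x₀))) (by simp; linarith) hBd ?_ (right_mem_Icc.2 hx)
  · have h2 : e * Real.exp (L * (x - x₀)) = ε := div_mul_cancel₀ _ (Real.exp_pos _).ne'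
    simp only [h2] at this
    linarith
  · intro t ht heq
    have hat : δ ≤ a t := hz ⟨ht.1, ht.2.le⟩
    rw [← heq, ← sub_div]
    have hwp : 0 < g t - f t := by rw [heq]; positivity
    have h3 : (m - H t (g t)) - (l - H t (f t)) ≤ K * (g t - f t) := by
      have := hL t
      rw [abs_sub_comm (f t), abs_of_pos hwp] at this
      linarith [le_abs_self (H t (f t) - H t (g t))]
    calc _ ≤ K * (g t - f t) / a t := by gcongr; exact (hpos t).le
      _ ≤ K * (g t - f t) / δ := by gcongr
      _ < (g t - f t) * L := by simp only [L]; field_simp; linarith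

/-- Pointwise limits of locally bounded `C¹` solutions are `C¹` solutions. -/
theorem IsC1Solution.of_tendsto {a : ℝ → ℝ} {H : ℝ → ℝ → ℝ} {l : ℕ → ℝ} {l' M : ℝ}
    {f : ℕ → ℝ → ℝ} {g : ℝ → ℝ} (ha : Continuous a) (hpos : ∀ x, 0 < a x)
    (hH : Continuous fun z : ℝ × ℝ => H z.1 z.2) (hf : ∀ n, IsC1Solution a H (l n) (f n))
    (hM : ∀ n x, |f n x| ≤ M) (hl : Tendsto l atTop (𝓝 l'))
    (hg : ∀ x, Tendsto (fun n => f n x) atTop (𝓝 (g x))) : IsC1Solution a H l' g := by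
  obtain ⟨Λ, hΛ⟩ : ∃ Λ, ∀ n, |l n| ≤ Λ := by
    obtain ⟨Λ, hΛ⟩ := (Metric.isBounded_range_of_tendsto l hl).exists_norm_le
    exact ⟨Λ, fun n => hΛ _ ⟨n, rfl⟩⟩
  have hF : Continuous fun z : ℝ × ℝ × ℝ => (z.1 - H z.2.1 z.2.2) / a z.2.1 :=
    (continuous_fst.sub (hH.comp continuous_snd)).div (ha.comp (continuous_fst.comp continuous_snd))
      fun z => (hpos _).ne'
  -- Local slope bounds uniform in `n`: they make `g` locally Lipschitz and dominate the integrands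
  -- when passing to the limit in the integrated equation.
  have hB : ∀ R : ℝ, ∃ B, ∀ n, ∀ x ∈ Icc (-R) R, |(l n - H x (f n x)) / a x| ≤ B := by
    intro R
    obtain ⟨B, hB⟩ := ((isCompact_Icc (a := -Λ) (b := Λ)).prod ((isCompact_Icc (a := -R)
      (b := R)).prod (isCompact_Icc (a := -M) (b := M)))).exists_bound_of_continuousOn
      hF.continuousOn
    exact ⟨B, fun n x hx => hB (l n, x, f n x) ⟨abs_le.1 (hΛ n), hx, abs_le.1 (hM n x)⟩⟩
  have hgc : Continuous g := by
    rw [continuous_iff_continuousAt]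
    intro x
    set R := |x| + 1
    obtain ⟨B, hB⟩ := hB R
    have hx : x ∈ Ioo (-R) R := abs_lt.1 (by simp [R])
    have hlip : LipschitzOnWith B.toNNReal g (Icc (-R) R) := by
      refine LipschitzOnWith.of_dist_le_mul fun y hy z hz => ?_
      refine le_of_tendsto ((hg y).dist (hg z)) (Eventually.of_forall fun n => ?_)
      refine (Convex.lipschitzOnWith_of_nnnorm_hasDerivWithin_le (convex_Icc (-R) R)
        (fun t _ => ((hf n).hasDerivAt hpos t).hasDerivWithinAt) (C := B.toNNReal)
        (fun t ht => ?_)).dist_le_mul _ hy _ hz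
      rw [← NNReal.coe_le_coe, coe_nnnorm]
      exact (hB n t ht).trans (Real.le_coe_toNNReal B)
    exact hlip.continuousOn.continuousAt (Icc_mem_nhds hx.1 hx.2)
  have hGc : Continuous fun s => (l' - H s (g s)) / a s :=
    hF.comp (continuous_const.prodMk (continuous_id.prodMk hgc))
  have hFnc : ∀ n, Continuous fun s => (l n - H s (f n s)) / a s := fun n =>
    hF.comp (continuous_const.prodMk (continuous_id.prodMk (hf n).1.continuous))
  have hint : ∀ x, g x = g 0 + ∫ s in (0 : ℝ)..x, (l' - H s (g s)) / a s := by
    intro x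
    obtain ⟨B, hB⟩ := hB |x|
    have h1 : Tendsto (fun n => ∫ s in (0 : ℝ)..x, (l n - H s (f n s)) / a s) atTop
        (𝓝 (∫ s in (0 : ℝ)..x, (l' - H s (g s)) / a s)) := by
      refine intervalIntegral.tendsto_integral_filter_of_dominated_convergence (fun _ => B)
        (Eventually.of_forall fun n => (hFnc n).aestronglyMeasurable)
        (Eventually.of_forall fun n => Eventually.of_forall fun s hs => ?_)
        intervalIntegrable_const (Eventually.of_forall fun s _ => ?_)
      · refine hB n s (abs_le.1 ?_)
        rcases le_total 0 x with h | h
        · rw [uIoc_of_le h] at hs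
          rw [abs_of_pos hs.1, abs_of_nonneg h]; exact hs.2
        · rw [uIoc_of_ge h] at hs
          rw [abs_of_nonpos hs.2, abs_of_nonpos h]; linarith [hs.1]
      · exact (hF.tendsto (l', s, g s)).comp
          (hl.prodMk_nhds (tendsto_const_nhds.prodMk_nhds (hg s)))
    have h2 : ∀ n, f n x = f n 0 + ∫ s in (0 : ℝ)..x, (l n - H s (f n s)) / a s := by
      intro n
      rw [intervalIntegral.integral_eq_sub_of_hasDerivAt (fun t _ => (hf n).hasDerivAt hpos t)
        ((hFnc n).intervalIntegrable _ _)]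
      ring
    exact tendsto_nhds_unique (hg x) (by simp_rw [h2]; exact (hg 0).add h1)
  have hder : ∀ x, HasDerivAt g ((l' - H x (g x)) / a x) x := by
    intro x
    have := (intervalIntegral.integral_hasDerivAt_right (hGc.intervalIntegrable 0 x)
      (hGc.stronglyMeasurableAtFilter _ _) hGc.continuousAt).const_add (g 0)
    exact this.congr_of_eventuallyEq (Eventually.of_forall hint)
  refine ⟨contDiff_one_iff_deriv.2 ⟨fun x => (hder x).differentiableAt, ?_⟩, fun x => ?_⟩
  · rwa [funext fun x => (hder x).deriv]
  · rw [(hder x).deriv, mul_div_cancel₀ _ (hpos x).ne']; ring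

/-- A primitive of a `C¹` solution is a viscosity supersolution. -/
theorem IsC1Solution.isViscositySupersolution {a : ℝ → ℝ} {H : ℝ → ℝ → ℝ} {l : ℝ} {f : ℝ → ℝ}
    (hf : IsC1Solution a H l f) (ha : ∀ x, 0 ≤ a x) :
    IsViscositySupersolution a H l fun x => ∫ s in (0 : ℝ)..x, f s := by
  have hu : ∀ x, HasDerivAt (fun x => ∫ s in (0 : ℝ)..x, f s) (f x) x := fun x =>
    intervalIntegral.integral_hasDerivAt_right (hf.1.continuous.intervalIntegrable 0 x)
      (hf.1.continuous.stronglyMeasurableAtFilter _ _) hf.1.continuous.continuousAt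
  refine ⟨continuous_iff_continuousAt.2 fun x => (hu x).continuousAt, fun φ x₀ hφ hmin => ?_⟩
  have hφ1 : ∀ x, HasDerivAt φ (deriv φ x) x := fun x =>
    (hφ.differentiable two_ne_zero x).hasDerivAt
  have hφ2 : HasDerivAt (deriv φ) (deriv (deriv φ) x₀) x₀ :=
    ((hφ.iterate_deriv' 1 1).differentiable one_ne_zero x₀).hasDerivAt
  have hd : deriv (fun x => φ x - ∫ s in (0 : ℝ)..x, f s) = fun x => deriv φ x - f x :=
    funext fun x => ((hφ1 x).sub (hu x)).deriv
  have hmax : IsLocalMax (fun x => φ x - ∫ s in (0 : ℝ)..x, f s) x₀ := by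
    filter_upwards [hmin] with x hx
    linarith
  have h1 : deriv φ x₀ = f x₀ := by
    have := hmax.deriv_eq_zero
    rw [hd] at this
    linarith
  have hdd : HasDerivAt (fun x => deriv φ x - f x) (deriv (deriv φ) x₀ - deriv f x₀) x₀ :=
    hφ2.sub (hf.1.differentiable one_ne_zero x₀).hasDerivAt
  have h2 : deriv (deriv φ) x₀ ≤ deriv f x₀ := by
    -- Otherwise `x₀` would also be a local minimum of `φ - u`, which would then be locally
    -- constant, contradicting its positive second derivative.
    by_contra! hlt
    have hmin' := isLocalMin_of_deriv_deriv_pos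
      (f := fun x => φ x - ∫ s in (0 : ℝ)..x, f s) (x₀ := x₀)
      (by rw [hd, hdd.deriv]; linarith) hmax.deriv_eq_zero
      ((hφ1 x₀).sub (hu x₀)).continuousAt
    have hconst : (fun x => φ x - ∫ s in (0 : ℝ)..x, f s) =ᶠ[𝓝 x₀]
        fun _ => φ x₀ - ∫ s in (0 : ℝ)..x₀, f s := by
      filter_upwards [hmax, hmin'] with x hx hx'
      exact le_antisymm hx hx'
    have h3 := hconst.deriv
    rw [hd] at h3
    have h4 := h3.deriv_eq
    rw [hdd.deriv] at h4
    simp at h4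
    linarith
  rw [← hf.2 x₀, h1]
  have := mul_le_mul_of_nonneg_left h2 (ha x₀)
  linarith

/-! ### Exponential kernels and the linear equation -/

/-- The density at `t > 0` of the first jump, looking backwards from `x`, of a Poisson process with
rate `c`. -/
noncomputable def expKernel (c : ℝ → ℝ) (x t : ℝ) : ℝ :=
  Real.exp (-∫ u in (0 : ℝ)..t, c (x - u)) * c (x - t)

theorem expKernel_nonneg {c : ℝ → ℝ} (hc : ∀ x, 0 ≤ c x) (x t : ℝ) : 0 ≤ expKernel c x t :=
  mul_nonneg (Real.exp_pos _).le (hc _)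

theorem continuous_expKernel {c : ℝ → ℝ} (hc : Continuous c) (x : ℝ) :
    Continuous (expKernel c x) := by
  have h1 : Continuous fun u => c (x - u) := by fun_prop
  have h2 : Continuous fun t => ∫ u in (0 : ℝ)..t, c (x - u) :=
    intervalIntegral.continuous_primitive (fun _ _ => h1.intervalIntegrable _ _) 0
  exact (Real.continuous_exp.comp h2.neg).mul h1

/-- The kernel is the `t`-derivative of minus the survival probability, which decays to zero because
the rate is at least `δ`. -/
theorem expKernel_integral {c : ℝ → ℝ} (hc : Continuous c) {δ : ℝ} (hδ : 0 < δ)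
    (hcδ : ∀ x, δ ≤ c x) (x : ℝ) :
    IntegrableOn (expKernel c x) (Ioi 0) ∧ ∫ t in Ioi 0, expKernel c x t = 1 := by
  have h1 : Continuous fun u => c (x - u) := by fun_prop
  have hd : ∀ t ∈ Ici (0 : ℝ), HasDerivAt (fun t => -Real.exp (-∫ u in (0 : ℝ)..t, c (x - u)))
      (expKernel c x t) t := by
    intro t _
    have := (intervalIntegral.integral_hasDerivAt_right (h1.intervalIntegrable 0 t)
      (h1.stronglyMeasurableAtFilter _ _) h1.continuousAt).neg.exp.neg
    refine this.congr_deriv ?_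
    simp [expKernel]
  have hlim : Tendsto (fun t => -Real.exp (-∫ u in (0 : ℝ)..t, c (x - u))) atTop (𝓝 0) := by
    rw [← neg_zero]
    refine (Real.tendsto_exp_atBot.comp (tendsto_neg_atTop_atBot.comp ?_)).neg
    refine tendsto_atTop_mono' _ ?_ (tendsto_id.const_mul_atTop hδ)
    filter_upwards [eventually_ge_atTop 0] with t ht
    have := intervalIntegral.integral_mono (μ := volume) ht (f := fun _ => δ)
      intervalIntegrable_const (h1.intervalIntegrable 0 t) fun u => hcδ (x - u)
    simpa [mul_comm] using this
  have hn : ∀ t ∈ Ioi (0 : ℝ), 0 ≤ expKernel c x t := fun t _ =>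
    expKernel_nonneg (fun y => hδ.le.trans (hcδ y)) x t
  refine ⟨integrableOn_Ioi_deriv_of_nonneg' hd hn hlim, ?_⟩
  rw [integral_Ioi_of_hasDerivAt_of_nonneg' hd hn hlim]
  simp

/-- The average of a function with values in `[r, M]` against the kernel. -/
theorem expKernel_average_mem {c : ℝ → ℝ} (hc : Continuous c) {δ : ℝ} (hδ : 0 < δ)
    (hcδ : ∀ x, δ ≤ c x) {h : ℝ → ℝ} (hm : Measurable h) {r M : ℝ} (hh : ∀ x, h x ∈ Icc r M)
    (x : ℝ) :
    IntegrableOn (fun t => expKernel c x t * h (x - t)) (Ioi 0) ∧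
      ∫ t in Ioi 0, expKernel c x t * h (x - t) ∈ Icc r M := by
  obtain ⟨hi, h1⟩ := expKernel_integral hc hδ hcδ x
  have hn := expKernel_nonneg (c := c) (fun y => hδ.le.trans (hcδ y)) x
  have hint : IntegrableOn (fun t => expKernel c x t * h (x - t)) (Ioi 0) := by
    refine Integrable.mul_bdd (c := max |r| |M|) hi
      (hm.comp (measurable_const.sub measurable_id)).aestronglyMeasurable
      (Eventually.of_forall fun t => ?_)
    exact abs_le_max_abs_abs (hh _).1 (hh _).2
  refine ⟨hint, ?_, ?_⟩
  · calc r = ∫ t in Ioi 0, expKernel c x t * r := by rw [integral_mul_const, h1, one_mul]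
      _ ≤ _ := integral_mono (hi.mul_const r) hint
        fun t => mul_le_mul_of_nonneg_left (hh _).1 (hn t)
  · calc ∫ t in Ioi 0, expKernel c x t * h (x - t)
        ≤ ∫ t in Ioi 0, expKernel c x t * M := integral_mono hint (hi.mul_const M)
          fun t => mul_le_mul_of_nonneg_left (hh _).2 (hn t)
      _ = M := by rw [integral_mul_const, h1, one_mul]

/-- Kernel averages solve the linear equation `g' = c (h - g)`. -/
theorem hasDerivAt_expKernel_average {c : ℝ → ℝ} (hc : Continuous c) {δ : ℝ} (hδ : 0 < δ)
    (hcδ : ∀ x, δ ≤ c x) {h : ℝ → ℝ} (hm : Measurable h) {r M : ℝ} (hh : ∀ x, h x ∈ Icc r M)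
    {g : ℝ → ℝ} (hg : ∀ x, g x = ∫ t in Ioi 0, expKernel c x t * h (x - t)) :
    Continuous g ∧ ∀ x, ContinuousAt h x → HasDerivAt g (c x * (h x - g x)) x := by
  set A : ℝ → ℝ := fun x => ∫ u in (0 : ℝ)..x, c u
  have hA : ∀ x, HasDerivAt A (c x) x := fun x =>
    intervalIntegral.integral_hasDerivAt_right (hc.intervalIntegrable 0 x)
      (hc.stronglyMeasurableAtFilter _ _) hc.continuousAt
  have hAc : Continuous A := continuous_iff_continuousAt.2 fun x => (hA x).continuousAt
  set ψ : ℝ → ℝ := fun s => Real.exp (A s) * c s * h s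
  -- Separating `x` from `x - t` turns the average into the variation of constants formula `exp (-A
  -- x) * ∫ ψ` over `(-∞, x]`.
  have hk : ∀ x t, expKernel c x t * h (x - t) = Real.exp (-A x) * ψ (x - t) := by
    intro x t
    have h1 : ∫ u in (0 : ℝ)..t, c (x - u) = A x - A (x - t) := by
      rw [intervalIntegral.integral_comp_sub_left]
      simp only [A, sub_zero]
      rw [intervalIntegral.integral_interval_sub_left] <;> exact hc.intervalIntegrable _ _
    simp only [expKernel, ψ, h1, neg_sub, sub_eq_add_neg (A (x - t)), Real.exp_add]
    ring
  have hpre : ∀ x : ℝ, (fun t => x - t) ⁻¹' Iio x = Ioi 0 := by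
    intro x; ext t; simp
  have hemb : ∀ x : ℝ, MeasurableEmbedding fun t : ℝ => x - t := fun x =>
    (MeasurableEquiv.subLeft x).measurableEmbedding
  have hψi : ∀ x, IntegrableOn ψ (Iic x) := by
    intro x
    rw [integrableOn_Iic_iff_integrableOn_Iio,
      ← (Measure.measurePreserving_sub_left volume x).integrableOn_comp_preimage (hemb x), hpre]
    have := (expKernel_average_mem hc hδ hcδ hm hh x).1.const_mul (Real.exp (A x))
    refine this.congr (Eventually.of_forall fun t => ?_)
    simp only [hk, Function.comp]
    rw [← mul_assoc, ← Real.exp_add]; simp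
  have hgψ : g = fun x => Real.exp (-A x) * ((∫ s in Iic 0, ψ s) + ∫ s in (0 : ℝ)..x, ψ s) := by
    funext x
    rw [hg, ← intervalIntegral.integral_Iic_sub_Iic (hψi 0) (hψi x)]
    simp_rw [hk]
    rw [integral_const_mul, integral_Iic_eq_integral_Iio, ← hpre x,
      (Measure.measurePreserving_sub_left volume x).setIntegral_preimage_emb (hemb x),
      integral_Iic_eq_integral_Iio (f := ψ) (x := x)]
    ring
  have hψii : ∀ a b, IntervalIntegrable ψ volume a b := by
    intro a b
    refine ⟨(hψi b).mono_set fun x hx => hx.2, (hψi a).mono_set fun x hx => hx.2⟩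
  have hψm : Measurable ψ := ((Real.measurable_exp.comp hAc.measurable).mul hc.measurable).mul hm
  constructor
  · rw [hgψ]
    exact (Real.continuous_exp.comp hAc.neg).mul
      (continuous_const.add (intervalIntegral.continuous_primitive hψii 0))
  · intro x hx
    have hψc : ContinuousAt ψ x :=
      ((Real.continuous_exp.comp hAc).mul hc).continuousAt.mul hx
    have h1 := (intervalIntegral.integral_hasDerivAt_right (hψii 0 x)
      hψm.stronglyMeasurable.stronglyMeasurableAtFilter hψc).const_add (∫ s in Iic 0, ψ s)
    have h2 := (hA x).neg.exp.mul h1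
    have hgx := congrFun hgψ x
    rw [hgx]
    have h3 : Real.exp (-A x) * ψ x = c x * h x := by
      simp only [ψ]
      rw [← mul_assoc, ← mul_assoc, ← Real.exp_add]; simp
    refine (h2.congr_of_eventuallyEq (Eventually.of_forall fun y => congrFun hgψ y)).congr_deriv ?_
    linear_combination h3

/-- Joint measurability of the kernel in all its arguments. -/
theorem measurable_expKernel {Ω : Type*} [MeasurableSpace Ω] {c : ℝ → Ω → ℝ}
    (hc : Measurable fun z : ℝ × Ω => c z.1 z.2) :
    Measurable fun z : (ℝ × Ω) × ℝ => expKernel (fun x => c x z.1.2) z.1.1 z.2 := by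
  have h1 : Measurable fun z : (ℝ × Ω) × ℝ =>
      ∫ u in (0 : ℝ)..z.2, c (z.1.1 - u) z.1.2 := by
    -- Rescaling `u = t v` fixes the domain of integration, so that measurability of parametric
    -- integrals applies.
    have h2 : ∀ z : (ℝ × Ω) × ℝ, ∫ u in (0 : ℝ)..z.2, c (z.1.1 - u) z.1.2 =
        z.2 * ∫ v in Ioc (0 : ℝ) 1, c (z.1.1 - z.2 * v) z.1.2 := by
      intro z
      have := intervalIntegral.mul_integral_comp_mul_left (a := 0) (b := 1)
        (f := fun u => c (z.1.1 - u) z.1.2) (c := z.2)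
      rw [mul_zero, mul_one] at this
      rw [← this, intervalIntegral.integral_of_le zero_le_one]
    simp_rw [h2]
    refine measurable_snd.mul (StronglyMeasurable.measurable ?_)
    refine StronglyMeasurable.integral_prod_right
      (f := fun (z : (ℝ × Ω) × ℝ) v => c (z.1.1 - z.2 * v) z.1.2) ?_
    refine Measurable.stronglyMeasurable ?_
    have h3 : Measurable fun p : ((ℝ × Ω) × ℝ) × ℝ => (p.1.1.1 - p.1.2 * p.2, p.1.1.2) := by
      fun_prop
    exact hc.comp h3
  have h4 : Measurable fun z : (ℝ × Ω) × ℝ => (z.1.1 - z.2, z.1.2) := by fun_prop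
  exact (Real.measurable_exp.comp h1.neg).mul (hc.comp h4)

theorem measurable_expKernel_average {Ω : Type*} [MeasurableSpace Ω] {c h : ℝ → Ω → ℝ}
    (hc : Measurable fun z : ℝ × Ω => c z.1 z.2) (hh : Measurable fun z : ℝ × Ω => h z.1 z.2) :
    Measurable fun z : ℝ × Ω =>
      ∫ t in Ioi 0, expKernel (fun x => c x z.2) z.1 t * h (z.1 - t) z.2 := by
  refine StronglyMeasurable.measurable ?_
  refine StronglyMeasurable.integral_prod_right
    (f := fun (z : ℝ × Ω) t => expKernel (fun x => c x z.2) z.1 t * h (z.1 - t) z.2) ?_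
  have h4 : Measurable fun z : (ℝ × Ω) × ℝ => (z.1.1 - z.2, z.1.2) := by fun_prop
  exact ((measurable_expKernel hc).mul (hh.comp h4)).stronglyMeasurable

theorem HamiltonianClass.continuous {Ω : Type*} {α₀ α₁ γ : ℝ} {H : ℝ → ℝ → Ω → ℝ}
    (hH : HamiltonianClass α₀ α₁ γ H) (hγ : 1 < γ) (ω : Ω) :
    Continuous fun z : ℝ × ℝ => H z.1 z.2 ω := by
  rw [continuous_iff_continuousAt]
  rintro ⟨x, p⟩
  rw [ContinuousAt, tendsto_iff_dist_tendsto_zero]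
  have hc : Continuous fun z : ℝ × ℝ =>
      α₁ * (|z.2| ^ γ + 1) * |z.1 - x| + α₁ * (|p| + |z.2| + 1) ^ (γ - 1) * |p - z.2| := by
    have h1 : Continuous fun z : ℝ × ℝ => |z.2| ^ γ :=
      continuous_snd.abs.rpow_const fun _ => Or.inr (by linarith)
    have h2 : Continuous fun z : ℝ × ℝ => (|p| + |z.2| + 1) ^ (γ - 1) :=
      ((continuous_const.add continuous_snd.abs).add continuous_const).rpow_const
        fun _ => Or.inr (by linarith)
    fun_prop
  refine squeeze_zero (fun _ => dist_nonneg) (fun z => ?_) (by simpa using hc.tendsto (x, p))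
  have h1 := hH.lipschitz_x z.1 x z.2 ω
  have h2 := hH.lipschitz_p x p z.2 ω
  rw [dist_comm, Real.dist_eq]
  calc |H x p ω - H z.1 z.2 ω| = |-(H z.1 z.2 ω - H x z.2 ω) + (H x p ω - H x z.2 ω)| := by
        congr 1; ring
    _ ≤ _ := (abs_add_le _ _).trans (by rw [abs_neg]; linarith)

theorem HamiltonianClass.lipschitz_of_abs_le {Ω : Type*} {α₀ α₁ γ : ℝ} {H : ℝ → ℝ → Ω → ℝ}
    (hH : HamiltonianClass α₀ α₁ γ H) (hα₁ : 0 ≤ α₁) (hγ : 1 < γ) {C x p q : ℝ} {ω : Ω}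
    (hp : |p| ≤ C) (hq : |q| ≤ C) :
    |H x p ω - H x q ω| ≤ α₁ * (C + C + 1) ^ (γ - 1) * |p - q| := by
  refine (hH.lipschitz_p x p q ω).trans ?_
  have : 0 ≤ γ - 1 := by linarith
  gcongr

/-! ### Ergodicity and stationary processes -/

section Stationary

variable {Ω : Type*} [MeasurableSpace Ω] {P : Measure Ω} {τ : ℝ → Ω → Ω}

theorem IsDiffusion.continuous {κ : ℝ} {a : ℝ → Ω → ℝ} (ha : IsDiffusion P τ κ a) (ω : Ω) :
    Continuous fun x => a x ω := by
  have h1 : Continuous fun x => √(a x ω) :=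
    (LipschitzWith.of_dist_le' fun x y => ha.sqrt_lipschitz x y ω).continuous
  refine (h1.pow 2).congr fun x => Real.sq_sqrt (ha.mem_Icc x ω).1

theorem IsStationary.eq_zero {f : ℝ → Ω → ℝ} (hf : IsStationary τ f) (x : ℝ) (ω : Ω) :
    f x ω = f 0 (τ x ω) := by
  simpa using hf.shift 0 x ω

theorem IsStationary.measurable_apply {f : ℝ → Ω → ℝ} (hf : IsStationary τ f) (x : ℝ) :
    Measurable (f x) :=
  hf.measurable.comp measurable_prodMk_left

theorem IsStationary.neg {f : ℝ → Ω → ℝ} (hf : IsStationary τ f) :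
    IsStationary τ fun x ω => -f x ω :=
  ⟨hf.measurable.neg, fun x y ω => congrArg _ (hf.shift x y ω)⟩

/-- A bounded observable which does not decrease along an ergodic flow is constant. -/
theorem IsErgodicFlow.ae_const_of_le (hτ : IsErgodicFlow P τ) {φ : Ω → ℝ} (hφ : Measurable φ)
    (hi : Integrable φ P) (hle : ∀ x, 0 ≤ x → ∀ᵐ ω ∂P, φ ω ≤ φ (τ x ω)) :
    ∃ c, ∀ᵐ ω ∂P, φ ω = c := by
  have hpos : ∀ x, 0 ≤ x → ∀ᵐ ω ∂P, φ (τ x ω) = φ ω := by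
    intro x hx
    have hix : Integrable (fun ω => φ (τ x ω)) P :=
      (hτ.measurePreserving x).integrable_comp_of_integrable hi
    -- The nonnegative increment has zero mean by invariance of `P`, hence vanishes almost surely.
    have hint : ∫ ω, (φ (τ x ω) - φ ω) ∂P = 0 := by
      rw [integral_sub hix hi, sub_eq_zero,
        ← integral_map (hτ.measurePreserving x).measurable.aemeasurable
          hφ.aestronglyMeasurable, (hτ.measurePreserving x).map_eq]
    have h0 := (integral_eq_zero_iff_of_nonneg_ae
      (by filter_upwards [hle x hx] with ω h using sub_nonneg.2 h) (hix.sub hi)).1 hint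
    filter_upwards [h0] with ω h using sub_eq_zero.1 h
  refine hτ.ergodic φ hφ fun x => ?_
  rcases le_total 0 x with hx | hx
  · exact hpos x hx
  · filter_upwards [(hτ.measurePreserving x).quasiMeasurePreserving.ae (hpos (-x) (by linarith))]
      with ω h
    rw [← hτ.add, neg_add_cancel, hτ.zero] at h
    exact h.symm

/-- A closed condition which holds almost surely at the origin holds almost surely along the whole
path of a stationary process with continuous paths. -/
theorem IsErgodicFlow.ae_forall_mem (hτ : IsErgodicFlow P τ) {E : Type*} [TopologicalSpace E]
    {F : ℝ → Ω → E} (hF : ∀ x ω, F x ω = F 0 (τ x ω))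
    (hc : ∀ᵐ ω ∂P, Continuous fun x => F x ω) {S : Set E} (hS : IsClosed S)
    (h0 : ∀ᵐ ω ∂P, F 0 ω ∈ S) : ∀ᵐ ω ∂P, ∀ x, F x ω ∈ S := by
  have hq : ∀ᵐ ω ∂P, ∀ q : ℚ, F q ω ∈ S := ae_all_iff.2 fun q => by
    filter_upwards [(hτ.measurePreserving q).quasiMeasurePreserving.ae h0] with ω h
    rwa [hF]
  filter_upwards [hc, hq] with ω h1 h2 x
  exact Rat.isDenseEmbedding_coe_real.dense.induction_on x (hS.preimage h1) h2

/-- A stationary process which strictly increases while it takes values in `(α, β)` almost surely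
avoids this interval. -/
theorem IsErgodicFlow.le_or_ge_of_deriv_pos [IsProbabilityMeasure P] (hτ : IsErgodicFlow P τ)
    {f : ℝ → Ω → ℝ} (hf : IsStationary τ f) {α β : ℝ} (hαβ : α < β)
    (hd : ∀ᵐ ω ∂P, (Differentiable ℝ fun x => f x ω) ∧
      ∀ x, f x ω ∈ Ioo α β → 0 < deriv (fun x => f x ω) x) :
    (∀ᵐ ω ∂P, ∀ x, f x ω ≤ α) ∨ ∀ᵐ ω ∂P, ∀ x, β ≤ f x ω := by
  have hcl : Continuous fun t : ℝ => max α (min β t) := by fun_prop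
  have hφ : Measurable fun ω => max α (min β (f 0 ω)) :=
    hcl.measurable.comp (hf.measurable_apply 0)
  obtain ⟨c, hc⟩ := hτ.ae_const_of_le hφ
    (Integrable.of_bound hφ.aestronglyMeasurable (max |α| |β|) (Eventually.of_forall fun ω =>
      abs_le_max_abs_abs (le_max_left _ _) (max_le hαβ.le (min_le_left _ _))))
    (fun x hx => by
      filter_upwards [hd] with ω h
      rw [← hf.eq_zero x]
      exact monotone_clamp_of_deriv_pos h.1 h.2 hx)
  have hall : ∀ᵐ ω ∂P, ∀ x, f x ω ∈ {t | max α (min β t) = c} :=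
    hτ.ae_forall_mem hf.eq_zero (hd.mono fun ω h => h.1.continuous)
      (isClosed_eq hcl continuous_const) hc
  rcases lt_or_ge α c with h1 | h1
  · rcases lt_or_ge c β with h2 | h2
    -- A truncation frozen strictly inside the band means that `f` itself is constant there, against
    -- the strict increase.
    · exfalso
      obtain ⟨ω, hω, hω'⟩ := (hd.and hall).exists
      have hfc : (fun x => f x ω) = fun _ => c := by
        funext x
        have : max α (min β (f x ω)) = c := hω' x
        rcases max_choice α (min β (f x ω)) with h | h
        · linarith
        · rcases min_choice β (f x ω) with h' | h' <;> linarith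
      have := hω.2 0 (by rw [show f 0 ω = c from congrFun hfc 0]; exact ⟨h1, h2⟩)
      rw [hfc] at this
      simp at this
    · right
      filter_upwards [hall] with ω h x
      have : β ≤ max α (min β (f x ω)) := h2.trans_eq (h x).symm
      rcases le_max_iff.1 this with h | h
      · linarith
      · exact (le_min_iff.1 h).2
  · left
    filter_upwards [hall] with ω h x
    have : min β (f x ω) ≤ α := ((le_max_right _ _).trans_eq (h x)).trans h1
    rcases min_le_iff.1 this with h | h
    · linarith
    · exact h

theorem IsErgodicFlow.le_or_ge_of_deriv_neg [IsProbabilityMeasure P] (hτ : IsErgodicFlow P τ)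
    {f : ℝ → Ω → ℝ} (hf : IsStationary τ f) {α β : ℝ} (hαβ : α < β)
    (hd : ∀ᵐ ω ∂P, (Differentiable ℝ fun x => f x ω) ∧
      ∀ x, f x ω ∈ Ioo α β → deriv (fun x => f x ω) x < 0) :
    (∀ᵐ ω ∂P, ∀ x, f x ω ≤ α) ∨ ∀ᵐ ω ∂P, ∀ x, β ≤ f x ω := by
  refine (hτ.le_or_ge_of_deriv_pos hf.neg (neg_lt_neg hαβ) ?_).symm.imp ?_ ?_
  · filter_upwards [hd] with ω h
    refine ⟨h.1.neg, fun x hx => ?_⟩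
    rw [deriv.fun_neg, neg_pos]
    exact h.2 x ⟨by linarith [hx.2], by linarith [hx.1]⟩
  · exact fun h => h.mono fun ω h x => by linarith [h x]
  · exact fun h => h.mono fun ω h x => by linarith [h x]

/-! ### Bounds and ordering of stationary solutions -/

section Solutions

variable {κ α₀ α₁ γ l m : ℝ} {a : ℝ → Ω → ℝ} {H : ℝ → ℝ → Ω → ℝ} {f g : ℝ → Ω → ℝ}

theorem IsStationarySolution.integrable [IsFiniteMeasure P]
    (hf : IsStationarySolution P τ a H l f) : Integrable (f 0) P := by
  obtain ⟨C, hC⟩ := hf.bounded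
  exact Integrable.of_bound (hf.stationary.measurable_apply 0).aestronglyMeasurable C
    (hC.mono fun ω h => h 0)

theorem IsStationarySolution.ae_continuous (hf : IsStationarySolution P τ a H l f) :
    ∀ᵐ ω ∂P, Continuous fun x => f x ω :=
  hf.solution.mono fun _ h => h.1.continuous

/-- Deterministic bound for stationary solutions in terms of the level. -/
theorem IsStationarySolution.ae_abs_le [IsProbabilityMeasure P] (hτ : IsErgodicFlow P τ)
    (ha : IsDiffusion P τ κ a) (hH : HamiltonianClass α₀ α₁ γ H) (hα₀ : 0 < α₀) (hγ : 0 < γ)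
    (hf : IsStationarySolution P τ a H l f) {M : ℝ} (hM : 0 ≤ M)
    (hl : l ≤ α₀ * M ^ γ - 1 / α₀) : ∀ᵐ ω ∂P, ∀ x, |f x ω| ≤ M := by
  obtain ⟨C, hC⟩ := hf.bounded
  -- `D` exceeds the a priori bound `C`, so the alternatives `f ≥ D` and `f ≤ -D` are excluded.
  set D := max M C + 1
  have hMD : M < D := (le_max_left M C).trans_lt (lt_add_one _)
  have hCD : C < D := (le_max_right M C).trans_lt (lt_add_one _)
  have hneg : ∀ᵐ ω ∂P, (Differentiable ℝ fun x => f x ω) ∧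
      ∀ x, M < |f x ω| → deriv (fun x => f x ω) x < 0 := by
    filter_upwards [hf.solution, ha.pos] with ω h hpos
    refine ⟨h.1.differentiable one_ne_zero, fun x hx => ?_⟩
    rw [h.deriv_eq hpos]
    refine div_neg_of_neg_of_pos ?_ (hpos x)
    have h1 := hH.growth_lower x (f x ω) ω
    have h2 : M ^ γ < |f x ω| ^ γ := Real.rpow_lt_rpow hM hx hγ
    nlinarith
  have hup : ∀ᵐ ω ∂P, ∀ x, f x ω ≤ M := by
    rcases hτ.le_or_ge_of_deriv_neg hf.stationary hMD (hneg.mono fun ω h =>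
      ⟨h.1, fun x hx => h.2 x (hx.1.trans_le (le_abs_self _))⟩) with h | h
    · exact h
    · obtain ⟨ω, h1, h2⟩ := (h.and hC).exists
      linarith [h1 0, le_abs_self (f 0 ω), h2 0]
  have hlow : ∀ᵐ ω ∂P, ∀ x, -M ≤ f x ω := by
    rcases hτ.le_or_ge_of_deriv_neg hf.stationary (neg_lt_neg hMD) (hneg.mono fun ω h =>
      ⟨h.1, fun x hx => h.2 x (by linarith [neg_abs_le (f x ω), neg_le_abs (f x ω), hx.2])⟩)
      with h | h
    · obtain ⟨ω, h1, h2⟩ := (h.and hC).exists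
      linarith [h1 0, neg_abs_le (f 0 ω), h2 0]
    · exact h
  filter_upwards [hup, hlow] with ω h1 h2 x using abs_le.2 ⟨h2 x, h1 x⟩

/-- Below `-1/α₀` the solution would decrease everywhere, so it would avoid a band chosen to contain
its whole range. -/
theorem IsStationarySolution.le_level [IsProbabilityMeasure P] (hτ : IsErgodicFlow P τ)
    (ha : IsDiffusion P τ κ a) (hH : HamiltonianClass α₀ α₁ γ H) (hα₀ : 0 < α₀)
    (hf : IsStationarySolution P τ a H l f) : -(1 / α₀) ≤ l := by
  by_contra! hl
  obtain ⟨C, hC⟩ := hf.bounded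
  have hCn : 0 ≤ C := by
    obtain ⟨ω, h⟩ := hC.exists
    exact (abs_nonneg _).trans (h 0)
  rcases hτ.le_or_ge_of_deriv_neg hf.stationary (α := -(C + 1)) (β := C + 1) (by linarith) (by
    filter_upwards [hf.solution, ha.pos] with ω h hpos
    refine ⟨h.1.differentiable one_ne_zero, fun x hx => ?_⟩
    rw [h.deriv_eq hpos]
    refine div_neg_of_neg_of_pos ?_ (hpos x)
    have h1 := hH.growth_lower x (f x ω) ω
    have h2 : 0 ≤ α₀ * |f x ω| ^ γ := by positivity
    linarith) with h | h
  · obtain ⟨ω, h1, h2⟩ := (h.and hC).exists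
    linarith [h1 0, neg_abs_le (f 0 ω), h2 0]
  · obtain ⟨ω, h1, h2⟩ := (h.and hC).exists
    linarith [h1 0, le_abs_self (f 0 ω), h2 0]

/-- At high levels, stationary solutions have a large mean. -/
theorem IsStationarySolution.le_abs_integral [IsProbabilityMeasure P] (hτ : IsErgodicFlow P τ)
    (ha : IsDiffusion P τ κ a) (hH : HamiltonianClass α₀ α₁ γ H) (hα₁ : 0 < α₁) (hγ : 0 < γ)
    (hf : IsStationarySolution P τ a H l f) {r : ℝ} (hr : 0 < r)
    (hl : α₁ * (r ^ γ + 1) < l) : r ≤ |∫ ω, f 0 ω ∂P| := by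
  rcases hτ.le_or_ge_of_deriv_pos hf.stationary (α := -r) (β := r) (by linarith) (by
    filter_upwards [hf.solution, ha.pos] with ω h hpos
    refine ⟨h.1.differentiable one_ne_zero, fun x hx => ?_⟩
    rw [h.deriv_eq hpos]
    refine div_pos ?_ (hpos x)
    have h1 := hH.growth_upper x (f x ω) ω
    have h2 : |f x ω| ^ γ ≤ r ^ γ :=
      Real.rpow_le_rpow (abs_nonneg _) (abs_lt.2 hx).le hγ.le
    nlinarith) with h | h
  · have := integral_mono_ae hf.integrable (integrable_const (-r)) (h.mono fun ω h => h 0)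
    rw [integral_const, probReal_univ, one_smul] at this
    linarith [neg_le_abs (∫ ω, f 0 ω ∂P)]
  · have := integral_mono_ae (integrable_const r) hf.integrable (h.mono fun ω h => h 0)
    rw [integral_const, probReal_univ, one_smul] at this
    exact this.trans (le_abs_self _)

/-- Comparison makes the indicator of `g 0 ω ≤ f 0 ω` nondecreasing along the flow, so it is almost
surely constant; continuity of paths extends the resulting order from the origin to every `x`. -/
theorem IsStationarySolution.ae_ge_or_ae_le_of_level_le [IsProbabilityMeasure P]
    (hτ : IsErgodicFlow P τ) (ha : IsDiffusion P τ κ a) (hH : HamiltonianClass α₀ α₁ γ H)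
    (hα₁ : 0 < α₁) (hγ : 1 < γ) (hf : IsStationarySolution P τ a H l f)
    (hg : IsStationarySolution P τ a H m g) (hml : m ≤ l) :
    (∀ᵐ ω ∂P, ∀ x, g x ω ≤ f x ω) ∨ ∀ᵐ ω ∂P, ∀ x, f x ω ≤ g x ω := by
  have hF : ∀ x ω, (f x ω, g x ω) = (f 0 (τ x ω), g 0 (τ x ω)) := fun x ω => by
    rw [hf.stationary.eq_zero, hg.stationary.eq_zero]
  have hFc : ∀ᵐ ω ∂P, Continuous fun x => (f x ω, g x ω) := by
    filter_upwards [hf.ae_continuous, hg.ae_continuous] with ω h1 h2 using h1.prodMk h2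
  obtain ⟨C, hC⟩ := hf.bounded
  obtain ⟨D, hD⟩ := hg.bounded
  have hA : MeasurableSet {ω | g 0 ω ≤ f 0 ω} :=
    measurableSet_le (hg.stationary.measurable_apply 0) (hf.stationary.measurable_apply 0)
  obtain ⟨c, hc⟩ := hτ.ae_const_of_le (φ := indicator {ω | g 0 ω ≤ f 0 ω} fun _ => 1)
    (measurable_const.indicator hA) ((integrable_const _).indicator hA) (fun x hx => by
      filter_upwards [hf.solution, hg.solution, ha.pos, hC, hD] with ω h1 h2 hpos h3 h4
      by_cases h : g 0 ω ≤ f 0 ω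
      · have h5 : 0 ≤ max C D := (abs_nonneg _).trans ((h3 0).trans (le_max_left _ _))
        have h6 := h1.le_of_le (ha.continuous ω) hpos h2 hml
          (K := α₁ * (max C D + max C D + 1) ^ (γ - 1)) (by positivity)
          (fun y => hH.lipschitz_of_abs_le hα₁.le hγ ((h3 y).trans (le_max_left _ _))
            ((h4 y).trans (le_max_right _ _))) hx h
        rw [hf.stationary.eq_zero, hg.stationary.eq_zero x] at h6
        rw [indicator_of_mem (show ω ∈ {ω | g 0 ω ≤ f 0 ω} from h),
          indicator_of_mem (show τ x ω ∈ {ω | g 0 ω ≤ f 0 ω} from h6)]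
      · rw [indicator_of_notMem (show ω ∉ {ω | g 0 ω ≤ f 0 ω} from h)]
        exact indicator_nonneg (fun _ _ => zero_le_one) _)
  by_cases h1 : c = 1
  · left
    refine hτ.ae_forall_mem (F := fun x ω => (f x ω, g x ω)) hF hFc
      (S := {p | p.2 ≤ p.1}) (isClosed_le continuous_snd continuous_fst) (hc.mono fun ω h => ?_)
    by_contra h2
    rw [indicator_of_notMem (show ω ∉ {ω | g 0 ω ≤ f 0 ω} from h2)] at h
    exact zero_ne_one (h.trans h1)
  · right
    refine hτ.ae_forall_mem (F := fun x ω => (f x ω, g x ω)) hF hFc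
      (S := {p | p.1 ≤ p.2}) (isClosed_le continuous_fst continuous_snd) (hc.mono fun ω h => ?_)
    by_contra h2
    have h3 : g 0 ω ≤ f 0 ω := (not_le.1 h2).le
    rw [indicator_of_mem (show ω ∈ {ω | g 0 ω ≤ f 0 ω} from h3)] at h
    exact h1 h.symm

/-- Any two stationary solutions, possibly at different levels, are ordered like their means. -/
theorem IsStationarySolution.ae_le_of_integral_le [IsProbabilityMeasure P]
    (hτ : IsErgodicFlow P τ) (ha : IsDiffusion P τ κ a) (hH : HamiltonianClass α₀ α₁ γ H)
    (hα₁ : 0 < α₁) (hγ : 1 < γ) (hf : IsStationarySolution P τ a H l f)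
    (hg : IsStationarySolution P τ a H m g) (hfg : ∫ ω, f 0 ω ∂P ≤ ∫ ω, g 0 ω ∂P) :
    ∀ᵐ ω ∂P, ∀ x, f x ω ≤ g x ω := by
  have hor : (∀ᵐ ω ∂P, ∀ x, g x ω ≤ f x ω) ∨ ∀ᵐ ω ∂P, ∀ x, f x ω ≤ g x ω := by
    rcases le_total m l with h | h
    · exact hf.ae_ge_or_ae_le_of_level_le hτ ha hH hα₁ hγ hg h
    · exact (hg.ae_ge_or_ae_le_of_level_le hτ ha hH hα₁ hγ hf h).symm
  rcases hor with h | h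
  · have h0 : ∀ᵐ ω ∂P, g 0 ω ≤ f 0 ω := h.mono fun ω h => h 0
    -- If the order is opposite to that of the means, the two solutions coincide.
    have heq : g 0 =ᵐ[P] f 0 := (integral_eq_iff_of_ae_le hg.integrable hf.integrable h0).1
      (le_antisymm (integral_mono_ae hg.integrable hf.integrable h0) hfg)
    refine hτ.ae_forall_mem (F := fun x ω => (f x ω, g x ω))
      (fun x ω => by rw [hf.stationary.eq_zero, hg.stationary.eq_zero])
      (by filter_upwards [hf.ae_continuous, hg.ae_continuous] with ω h1 h2 using h1.prodMk h2)
      (S := {p | p.1 ≤ p.2}) (isClosed_le continuous_fst continuous_snd)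
      (heq.mono fun ω h => h.symm.le)
  · exact h

/-! ### Stability and closedness -/

/-- Levels of stationary solutions lie above the critical value. -/
theorem IsStationarySolution.lambdaZero_le (ha : IsDiffusion P τ κ a)
    (hf : IsStationarySolution P τ a H l f) : lambdaZero P a H ≤ (l : EReal) := by
  refine essSup_le_of_ae_le _ (hf.solution.mono fun ω h => ?_)
  exact sInf_le ⟨l, rfl, _, h.isViscositySupersolution fun x => (ha.mem_Icc x ω).1⟩

theorem mem_imTheta_iff (ha : IsDiffusion P τ κ a) {θ : ℝ} :
    θ ∈ imTheta P τ a H ↔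
      ∃ l f, IsStationarySolution P τ a H l f ∧ θ = ∫ ω, f 0 ω ∂P := by
  simp only [imTheta, Theta, mem_iUnion, mem_ofPred_eq, exists_prop]
  exact ⟨fun ⟨l, _, h⟩ => ⟨l, h⟩, fun ⟨l, f, hf, h⟩ => ⟨l, hf.lambdaZero_le ha, f, hf, h⟩⟩

/-- Stability of stationary solutions under pointwise convergence. -/
theorem IsStationarySolution.of_tendsto [IsProbabilityMeasure P] (ha : IsDiffusion P τ κ a)
    (hH : HamiltonianClass α₀ α₁ γ H) (hγ : 1 < γ) {L : ℕ → ℝ} {F : ℕ → ℝ → Ω → ℝ}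
    (hF : ∀ n, IsStationarySolution P τ a H (L n) (F n)) (hL : Tendsto L atTop (𝓝 l)) {M : ℝ}
    (hM : ∀ᵐ ω ∂P, ∀ n x, |F n x ω| ≤ M)
    (hlim : ∀ᵐ ω ∂P, ∀ x, ∃ y, Tendsto (fun n => F n x ω) atTop (𝓝 y)) :
    ∃ f, IsStationarySolution P τ a H l f ∧
      Tendsto (fun n => ∫ ω, F n 0 ω ∂P) atTop (𝓝 (∫ ω, f 0 ω ∂P)) := by
  -- The `limsup` is jointly measurable and shifts correctly for every `ω`, including those where
  -- the sequence diverges.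
  set f : ℝ → Ω → ℝ := fun x ω => limsup (fun n => F n x ω) atTop
  have hf : ∀ᵐ ω ∂P, ∀ x, Tendsto (fun n => F n x ω) atTop (𝓝 (f x ω)) := by
    filter_upwards [hlim] with ω h x
    obtain ⟨y, hy⟩ := h x
    simpa only [f, hy.limsup_eq] using hy
  refine ⟨f, ⟨⟨?_, fun x y ω => ?_⟩, ⟨M, ?_⟩, ?_⟩, ?_⟩
  · exact Measurable.limsup fun n => (hF n).stationary.measurable
  · simp only [f, (hF _).stationary.shift x y ω]
  · filter_upwards [hM, hf] with ω h1 h2 x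
    exact le_of_tendsto (h2 x).abs (Eventually.of_forall fun n => h1 n x)
  · filter_upwards [hM, hf, ha.pos, ae_all_iff.2 fun n => (hF n).solution] with ω h1 h2 hpos h3
    exact IsC1Solution.of_tendsto (ha.continuous ω) hpos (hH.continuous hγ ω) h3 h1 hL h2
  · exact tendsto_integral_of_dominated_convergence (fun _ => M)
      (fun n => ((hF n).stationary.measurable_apply 0).aestronglyMeasurable)
      (integrable_const M) (fun n => hM.mono fun ω h => h n 0) (hf.mono fun ω h => h 0)

theorem isClosed_imTheta [IsProbabilityMeasure P] (hτ : IsErgodicFlow P τ)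
    (ha : IsDiffusion P τ κ a) (hH : HamiltonianClass α₀ α₁ γ H) (hα₀ : 0 < α₀) (hα₁ : 0 < α₁)
    (hγ : 1 < γ) : IsClosed (imTheta P τ a H) := by
  refine IsSeqClosed.isClosed fun θ θ' hθ hlim => ?_
  simp only [mem_imTheta_iff ha] at hθ ⊢
  choose L F hF hθF using hθ
  obtain ⟨R, hR⟩ := (Metric.isBounded_range_of_tendsto θ hlim).exists_norm_le
  have hR0 : 0 ≤ R := (norm_nonneg _).trans (hR _ ⟨0, rfl⟩)
  -- A level above this bound would force a mean of modulus at least `R + 1`, while all the means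
  -- are bounded by `R`.
  have hLmem : ∀ n, L n ∈ Icc (-(1 / α₀)) (α₁ * ((R + 1) ^ γ + 1)) := by
    refine fun n => ⟨(hF n).le_level hτ ha hH hα₀, ?_⟩
    by_contra! h
    have h1 := (hF n).le_abs_integral hτ ha hH hα₁ (by linarith) (by linarith) h
    have h2 := hR _ ⟨n, rfl⟩
    rw [Real.norm_eq_abs, hθF] at h2
    linarith
  obtain ⟨l, -, σ, hσ, hσl⟩ := isCompact_Icc.tendsto_subseq hLmem
  obtain ⟨M, hM0, hM⟩ : ∃ M, 0 ≤ M ∧ α₁ * ((R + 1) ^ γ + 1) ≤ α₀ * M ^ γ - 1 / α₀ := by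
    have := ((tendsto_rpow_atTop (y := γ) (by linarith)).const_mul_atTop hα₀)
    obtain ⟨M, h1, h2⟩ := ((eventually_ge_atTop (0 : ℝ)).and
      (this.eventually_ge_atTop (α₁ * ((R + 1) ^ γ + 1) + 1 / α₀))).exists
    exact ⟨M, h1, by linarith⟩
  have hMall : ∀ᵐ ω ∂P, ∀ n x, |F n x ω| ≤ M := ae_all_iff.2 fun n =>
    (hF n).ae_abs_le hτ ha hH hα₀ (by linarith) hM0 ((hLmem n).2.trans hM)
  have hord : ∀ᵐ ω ∂P, ∀ n m, θ n ≤ θ m → ∀ x, F n x ω ≤ F m x ω := by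
    refine ae_all_iff.2 fun n => ae_all_iff.2 fun m => ?_
    by_cases h : θ n ≤ θ m
    · rw [hθF, hθF] at h
      exact ((hF n).ae_le_of_integral_le hτ ha hH hα₁ hγ (hF m) h).mono fun ω h _ => h
    · exact Eventually.of_forall fun ω h' => absurd h' h
  -- Monotone means give monotone solutions, so a single subsequence converges for almost every `ω`;
  -- compactness for each `ω` separately would not provide this.
  obtain ⟨ρ, hρ⟩ := exists_increasing_or_nonincreasing_subseq (· < ·) fun n => θ (σ n)
  have hmono : Antitone (fun n => θ (σ (ρ n))) ∨ Monotone (fun n => θ (σ (ρ n))) := by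
    rcases hρ with h | h
    · right
      exact monotone_nat_of_le_succ fun n => by linarith [h n (n + 1) (Nat.lt_succ_self n)]
    · left
      exact antitone_nat_of_succ_le fun n => by linarith [h n (n + 1) (Nat.lt_succ_self n)]
  obtain ⟨f, hf, hfl⟩ := IsStationarySolution.of_tendsto ha hH hγ (fun n => hF (σ (ρ n)))
    (hσl.comp ρ.strictMono.tendsto_atTop) (hMall.mono fun ω h n => h _) (by
      filter_upwards [hMall, hord] with ω h1 h2 x
      rcases hmono with h | h
      · exact ⟨_, tendsto_atTop_ciInf (fun i j hij => h2 _ _ (h hij) x)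
          ⟨-M, by rintro _ ⟨n, rfl⟩; exact (abs_le.1 (h1 _ x)).1⟩⟩
      · exact ⟨_, tendsto_atTop_ciSup (fun i j hij => h2 _ _ (h hij) x)
          ⟨M, by rintro _ ⟨n, rfl⟩; exact (abs_le.1 (h1 _ x)).2⟩⟩)
  refine ⟨l, f, hf, tendsto_nhds_unique ?_ hfl⟩
  simp_rw [← hθF]
  exact hlim.comp (hσ.comp ρ.strictMono).tendsto_atTop

end Solutions

end Stationary

/-! ### Existence by monotone iteration -/

/-- The right-hand side of the fixed point formulation `f = 𝔼[picardMap f(jump point)]` of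
`a f' + H(x, f) = l`, where jumps have rate `C / a`. -/
noncomputable def picardMap {Ω : Type*} (H : ℝ → ℝ → Ω → ℝ) (l C s p : ℝ) (ω : Ω) : ℝ :=
  p + (l - H s p ω) / C

/-- Monotone iteration, started from `M`, for the equation `a f' + H(x, f) = l`. -/
noncomputable def picardIterate {Ω : Type*} (a : ℝ → Ω → ℝ) (H : ℝ → ℝ → Ω → ℝ) (l C M : ℝ) :
    ℕ → ℝ → Ω → ℝ
  | 0 => fun _ _ => M
  | k + 1 => fun x ω => ∫ t in Ioi 0, expKernel (fun y => C / a y ω) x t *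
      picardMap H l C (x - t) (picardIterate a H l C M k (x - t) ω) ω

section

variable {Ω : Type*} {α₀ α₁ γ l M r : ℝ} {H : ℝ → ℝ → Ω → ℝ}

/-- The constant dividing `H` is its Lipschitz constant in `p` on `[-M, M]`, so adding `p`
compensates any increase of `H`. -/
theorem picardMap_mono (hH : HamiltonianClass α₀ α₁ γ H) (hα₁ : 0 < α₁) (hγ : 1 < γ)
    (hM : 0 ≤ M) {s p q : ℝ} {ω : Ω} (hp : |p| ≤ M) (hq : |q| ≤ M) (hpq : p ≤ q) :
    picardMap H l (α₁ * (M + M + 1) ^ (γ - 1)) s p ω ≤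
      picardMap H l (α₁ * (M + M + 1) ^ (γ - 1)) s q ω := by
  have h1 := hH.lipschitz_of_abs_le hα₁.le hγ hp hq (x := s) (ω := ω)
  have hC : 0 < α₁ * (M + M + 1) ^ (γ - 1) := by positivity
  set C := α₁ * (M + M + 1) ^ (γ - 1)
  rw [abs_sub_comm p, abs_of_nonneg (sub_nonneg.2 hpq)] at h1
  have h2 := (abs_le.1 h1).1
  have h3 : (H s q ω - H s p ω) / C ≤ q - p := by
    rw [div_le_iff₀ hC]; linarith
  simp only [picardMap]
  rw [sub_div] at h3
  rw [sub_div, sub_div]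
  linarith

/-- By monotonicity only the endpoints matter: the map moves `r` up and `M` down, by the two growth
bounds. -/
theorem picardMap_mem (hH : HamiltonianClass α₀ α₁ γ H) (hα₁ : 0 < α₁) (hγ : 1 < γ)
    (hr : 0 ≤ r) (hrM : r ≤ M) (hl : α₁ * (r ^ γ + 1) ≤ l) (hlM : l ≤ α₀ * M ^ γ - 1 / α₀)
    {s p : ℝ} {ω : Ω} (hp : p ∈ Icc r M) :
    picardMap H l (α₁ * (M + M + 1) ^ (γ - 1)) s p ω ∈ Icc r M := by
  have hM : 0 ≤ M := hr.trans hrM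
  have hC : 0 < α₁ * (M + M + 1) ^ (γ - 1) := by positivity
  have hp' : |p| ≤ M := by rw [abs_of_nonneg (hr.trans hp.1)]; exact hp.2
  have hr' : |r| ≤ M := by rwa [abs_of_nonneg hr]
  have hM' : |M| ≤ M := by rw [abs_of_nonneg hM]
  constructor
  · refine le_trans ?_ (picardMap_mono hH hα₁ hγ hM hr' hp' hp.1)
    have := hH.growth_upper s r ω
    rw [abs_of_nonneg hr] at this
    have : 0 ≤ (l - H s r ω) / (α₁ * (M + M + 1) ^ (γ - 1)) := div_nonneg (by linarith) hC.le
    simp only [picardMap]; linarith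
  · refine (picardMap_mono hH hα₁ hγ hM hp' hM' hp.2).trans ?_
    have := hH.growth_lower s M ω
    rw [abs_of_nonneg hM] at this
    have : (l - H s M ω) / (α₁ * (M + M + 1) ^ (γ - 1)) ≤ 0 :=
      div_nonpos_of_nonpos_of_nonneg (by linarith) hC.le
    simp only [picardMap]; linarith

end

variable {Ω : Type*} [MeasurableSpace Ω] {P : Measure Ω} {τ : ℝ → Ω → Ω}
  {κ α₀ α₁ γ l M r : ℝ} {a : ℝ → Ω → ℝ} {H : ℝ → ℝ → Ω → ℝ}

theorem measurable_picardMap (hH : IsStationaryHamiltonian τ H) (l C : ℝ) {g : ℝ → Ω → ℝ}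
    (hg : Measurable fun z : ℝ × Ω => g z.1 z.2) :
    Measurable fun z : ℝ × Ω => picardMap H l C z.1 (g z.1 z.2) z.2 :=
  hg.add ((measurable_const.sub (hH.measurable.comp
    (measurable_fst.prodMk (hg.prodMk measurable_snd)))).div_const C)

/-- The kernel sees `a` and `H` only relative to the base point, so shifts commute with the
iteration for every `ω`, even where `a` vanishes. -/
theorem isStationary_picardIterate (ha : IsStationary τ a) (hH : IsStationaryHamiltonian τ H)
    (l C M : ℝ) (k : ℕ) : IsStationary τ (picardIterate a H l C M k) := by
  induction k with
  | zero => exact ⟨measurable_const, fun _ _ _ => rfl⟩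
  | succ k ih =>
    refine ⟨measurable_expKernel_average (c := fun x ω => C / a x ω)
      (h := fun x ω => picardMap H l C x (picardIterate a H l C M k x ω) ω)
      (measurable_const.div ha.measurable) (measurable_picardMap hH l C ih.measurable),
      fun x y ω => ?_⟩
    have h1 : ∀ t, x + y - t = x - t + y := fun t => by ring
    simp only [picardIterate, expKernel, picardMap, h1, ha.shift _ y, hH.shift _ y, ih.shift _ y]

variable {ω : Ω}

theorem picardIterate_mem (ha : IsDiffusion P τ κ a) (hHs : IsStationaryHamiltonian τ H)
    (hH : HamiltonianClass α₀ α₁ γ H) (hα₁ : 0 < α₁) (hγ : 1 < γ)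
    (hr : 0 ≤ r) (hrM : r ≤ M) (hl : α₁ * (r ^ γ + 1) ≤ l) (hlM : l ≤ α₀ * M ^ γ - 1 / α₀)
    (hc : Continuous fun x => α₁ * (M + M + 1) ^ (γ - 1) / a x ω)
    (hcC : ∀ x, α₁ * (M + M + 1) ^ (γ - 1) ≤ α₁ * (M + M + 1) ^ (γ - 1) / a x ω)
    (k : ℕ) : ∀ x, picardIterate a H l (α₁ * (M + M + 1) ^ (γ - 1)) M k x ω ∈ Icc r M := by
  have hM : 0 ≤ M := hr.trans hrM
  induction k with
  | zero => exact fun x => ⟨hrM, le_rfl⟩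
  | succ k ih =>
    intro x
    exact (expKernel_average_mem hc (by positivity) hcC
      ((measurable_picardMap hHs l _ (isStationary_picardIterate ha.stationary hHs l _ M
        k).measurable).comp measurable_prodMk_right)
      (fun y => picardMap_mem hH hα₁ hγ hr hrM hl hlM (ih y)) x).2

/-- Between a constant subsolution `r` and a constant supersolution `M` there is a stationary
solution. -/
theorem exists_isStationarySolution (ha : IsDiffusion P τ κ a)
    (hHs : IsStationaryHamiltonian τ H) (hH : HamiltonianClass α₀ α₁ γ H) (hα₁ : 0 < α₁)
    (hγ : 1 < γ) (hr : 0 ≤ r) (hrM : r ≤ M) (hl : α₁ * (r ^ γ + 1) ≤ l)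
    (hlM : l ≤ α₀ * M ^ γ - 1 / α₀) :
    ∃ f, IsStationarySolution P τ a H l f ∧ ∀ᵐ ω ∂P, ∀ x, r ≤ f x ω := by
  have hM : 0 ≤ M := hr.trans hrM
  set C := α₁ * (M + M + 1) ^ (γ - 1) with hCdef
  have hC : 0 < C := by positivity
  set G := picardIterate a H l C M
  have hGs : ∀ k, IsStationary τ (G k) := isStationary_picardIterate ha.stationary hHs l C M
  have hgood : ∀ᵐ ω ∂P, (∀ x, (⨅ k, G k x ω) ∈ Icc r M) ∧
      IsC1Solution (fun x => a x ω) (fun x p => H x p ω) l fun x => ⨅ k, G k x ω := by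
    filter_upwards [ha.pos] with ω hpos
    have hc : Continuous fun x => C / a x ω :=
      continuous_const.div (ha.continuous ω) fun x => (hpos x).ne'
    -- Since `a ≤ 1`, the rate is at least `C`, which gives the kernel total mass one.
    have hcC : ∀ x, C ≤ C / a x ω := fun x =>
      le_div_self hC.le (hpos x) (ha.mem_Icc x ω).2
    have hmem : ∀ k x, G k x ω ∈ Icc r M :=
      picardIterate_mem ha hHs hH hα₁ hγ hr hrM hl hlM hc hcC
    have habs : ∀ k x, |G k x ω| ≤ M := fun k x => by
      rw [abs_of_nonneg (hr.trans (hmem k x).1)]; exact (hmem k x).2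
    have hPmem : ∀ {s p : ℝ}, p ∈ Icc r M → picardMap H l C s p ω ∈ Icc r M :=
      fun hp => picardMap_mem hH hα₁ hγ hr hrM hl hlM hp
    have hHc := hH.continuous hγ ω
    have hPc : Continuous fun z : ℝ × ℝ => picardMap H l C z.1 z.2 ω :=
      continuous_snd.add ((continuous_const.sub hHc).div_const C)
    have hPG : ∀ k, Measurable fun s => picardMap H l C s (G k s ω) ω := fun k =>
      (measurable_picardMap hHs l C (hGs k).measurable).comp measurable_prodMk_right
    have hsucc : ∀ k x, G (k + 1) x ω = ∫ t in Ioi 0, expKernel (fun y => C / a y ω) x t *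
        picardMap H l C (x - t) (G k (x - t) ω) ω := fun _ _ => rfl
    have hkn : ∀ x t, 0 ≤ expKernel (fun y => C / a y ω) x t :=
      expKernel_nonneg fun y => hC.le.trans (hcC y)
    have hav := fun k x => expKernel_average_mem hc hC hcC (hPG k) (fun s => hPmem (hmem k s)) x
    have hanti : ∀ x, Antitone fun k => G k x ω := by
      have h1 : ∀ k x, G (k + 1) x ω ≤ G k x ω := by
        intro k
        induction k with
        | zero => exact fun x => (hmem 1 x).2
        | succ k ih =>
          intro x
          rw [hsucc, hsucc k]
          exact integral_mono (hav (k + 1) x).1 (hav k x).1 fun t =>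
            mul_le_mul_of_nonneg_left
              (picardMap_mono hH hα₁ hγ hM (habs _ _) (habs _ _) (ih _)) (hkn x t)
      exact fun x => antitone_nat_of_succ_le fun k => h1 k x
    set g : ℝ → ℝ := fun x => ⨅ k, G k x ω
    have hlim : ∀ x, Tendsto (fun k => G k x ω) atTop (𝓝 (g x)) := fun x =>
      tendsto_atTop_ciInf (hanti x) ⟨r, by rintro _ ⟨k, rfl⟩; exact (hmem k x).1⟩
    have hgmem : ∀ x, g x ∈ Icc r M := fun x =>
      isClosed_Icc.mem_of_tendsto (hlim x) (Eventually.of_forall fun k => hmem k x)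
    have hPlim : ∀ s, Tendsto (fun k => picardMap H l C s (G k s ω) ω) atTop
        (𝓝 (picardMap H l C s (g s) ω)) := fun s =>
      (hPc.tendsto (s, g s)).comp (tendsto_const_nhds.prodMk_nhds (hlim s))
    have hPg : Measurable fun s => picardMap H l C s (g s) ω :=
      measurable_of_tendsto_metrizable hPG (tendsto_pi_nhds.2 hPlim)
    have hfix : ∀ x, g x = ∫ t in Ioi 0, expKernel (fun y => C / a y ω) x t *
        picardMap H l C (x - t) (g (x - t)) ω := by
      intro x
      refine tendsto_nhds_unique ((tendsto_add_atTop_iff_nat 1).2 (hlim x)) ?_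
      simp_rw [hsucc]
      refine tendsto_integral_of_dominated_convergence
        (fun t => expKernel (fun y => C / a y ω) x t * M)
        (fun k => (hav k x).1.aestronglyMeasurable)
        ((expKernel_integral hc hC hcC x).1.mul_const M)
        (fun k => Eventually.of_forall fun t => ?_)
        (Eventually.of_forall fun t => (hPlim _).const_mul _)
      have h1 := hPmem (s := x - t) (hmem k (x - t))
      rw [Real.norm_eq_abs, abs_of_nonneg (mul_nonneg (hkn x t) (hr.trans h1.1))]
      exact mul_le_mul_of_nonneg_left h1.2 (hkn x t)
    obtain ⟨hgc, hgd⟩ := hasDerivAt_expKernel_average hc hC hcC hPg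
      (fun s => hPmem (hgmem s)) hfix
    -- The linear equation `g' = (C / a) * (picardMap - g)` reduces to the ODE, as `picardMap - g =
    -- (l - H) / C`.
    have hder : ∀ x, HasDerivAt g ((l - H x (g x) ω) / a x ω) x := fun x => by
      refine (hgd x (hPc.comp (continuous_id.prodMk hgc)).continuousAt).congr_deriv ?_
      have := (hpos x).ne'
      simp only [picardMap]
      field_simp
      ring
    refine ⟨hgmem, contDiff_one_iff_deriv.2 ⟨fun x => (hder x).differentiableAt, ?_⟩, fun x => ?_⟩
    · rw [funext fun x => (hder x).deriv]
      exact (continuous_const.sub (hHc.comp (continuous_id.prodMk hgc))).div (ha.continuous ω)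
        fun x => (hpos x).ne'
    · rw [(hder x).deriv, mul_div_cancel₀ _ (hpos x).ne']
      exact sub_add_cancel _ _
  refine ⟨fun x ω => ⨅ k, G k x ω, ⟨⟨?_, fun x y ω => ?_⟩, ⟨M, ?_⟩, ?_⟩, ?_⟩
  · exact Measurable.iInf fun k => (hGs k).measurable
  · simp only [(hGs _).shift x y ω]
  · filter_upwards [hgood] with ω h x
    rw [abs_of_nonneg (hr.trans (h.1 x).1)]
    exact (h.1 x).2
  · exact hgood.mono fun ω h => h.2
  · exact hgood.mono fun ω h x => (h.1 x).1

theorem not_isBounded_imTheta [IsProbabilityMeasure P] (ha : IsDiffusion P τ κ a)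
    (hHs : IsStationaryHamiltonian τ H) (hH : HamiltonianClass α₀ α₁ γ H) (hα₀ : 0 < α₀)
    (hα₁ : 0 < α₁) (hγ : 1 < γ) : ¬ Bornology.IsBounded (imTheta P τ a H) := by
  intro hb
  obtain ⟨R, hR⟩ := hb.exists_norm_le
  set r := |R| + 1
  have hr : 0 ≤ r := by positivity
  obtain ⟨M, hrM, hM⟩ := ((eventually_ge_atTop r).and
    (((tendsto_rpow_atTop (y := γ) (by linarith)).const_mul_atTop hα₀).eventually_ge_atTop
      (α₁ * (r ^ γ + 1) + 1 / α₀))).exists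
  -- The level is `α₁ * (r ^ γ + 1)`, the least one for which the upper growth bound makes `r` a
  -- subsolution.
  obtain ⟨f, hf, hrf⟩ := exists_isStationarySolution ha hHs hH hα₁ hγ hr hrM le_rfl
    (by linarith)
  have h1 := integral_mono_ae (integrable_const r) hf.integrable (hrf.mono fun ω h => h 0)
  rw [integral_const, probReal_univ, one_smul] at h1
  have h2 := (le_abs_self _).trans (hR _ ((mem_imTheta_iff ha).2 ⟨_, f, hf, rfl⟩))
  linarith [le_abs_self R, show r = |R| + 1 from rfl]

end ViscousHJ

theorem proposition5p2 {Ω : Type*} [MeasurableSpace Ω] (P : Measure Ω) [IsProbabilityMeasure P]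
    (τ : ℝ → Ω → Ω) (hτ : ViscousHJ.IsErgodicFlow P τ)
    (κ : ℝ) (hκ : 0 < κ) (a : ℝ → Ω → ℝ) (ha : ViscousHJ.IsDiffusion P τ κ a)
    (α₀ α₁ γ : ℝ) (hα₀ : 0 < α₀) (hα₁ : 0 < α₁) (hγ : 2 < γ)
    (H : ℝ → ℝ → Ω → ℝ) (hHs : ViscousHJ.IsStationaryHamiltonian τ H)
    (hH : ViscousHJ.HamiltonianClass α₀ α₁ γ H) :
    IsClosed (ViscousHJ.imTheta P τ a H) ∧
      ¬ Bornology.IsBounded (ViscousHJ.imTheta P τ a H) :=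
  ⟨ViscousHJ.isClosed_imTheta hτ ha hH hα₀ hα₁ (by linarith),
    ViscousHJ.not_isBounded_imTheta ha hHs hH hα₀ hα₁ (by linarith)⟩
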